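/- For a graph $H$ and a positive integer $n$, the regular Turán number $\mathrm{ex}_r(n,H)$ is the largest integer $k$ for which there is a $k$-regular (finite simple) graph on $n$ vertices that does not contain $H$ as a (not necessarily induced) subgraph. Let $C_m$ denote the cycle of length $m$. **Theorem.** Let $\ell\ge 3$ be an integer. Then there is an integer $N$, depending only on $\ell$, such that for all $n\ge N$ $$\mathrm{ex}_r(n,C_{2\ell-1})=\begin{cases}\dfrac n2 & \text{if } n \text{ is even},\\[2mm] 2\left\lfloor \dfrac n{2\ell+1}\right\rfloor & \text{if } n \text{ is odd}.\end{cases}$$ -/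

import Mathlib

/-- The degrees `k` for which there is a `k`-regular graph on `n` vertices that does not contain
`H` as a (not necessarily induced) subgraph. -/
def regularFreeDegrees {W : Type*} (n : ℕ) (H : SimpleGraph W) : Set ℕ :=
  {k | ∃ (G : SimpleGraph (Fin n)) (_ : DecidableRel G.Adj),
    G.IsRegularOfDegree k ∧ H.Free G}

/-- The regular Turán number `ex_r(n, H)`: the largest `k` for which there is a `k`-regular
graph on `n` vertices not containing `H` as a subgraph. -/
noncomputable def regularTuranNumber {W : Type*} (n : ℕ) (H : SimpleGraph W) : ℕ :=
  sSup (regularFreeDegrees n H)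

/-- The supremum in the definition is a genuine maximum as soon as `n` is positive and `H` has
an edge. -/
theorem isGreatest_regularTuranNumber {W : Type*} {n : ℕ} (hn : 0 < n) (H : SimpleGraph W)
    (hH : ∃ u v, H.Adj u v) :
    IsGreatest (regularFreeDegrees n H) (regularTuranNumber n H) := by
  have hne : (regularFreeDegrees n H).Nonempty := by
    refine ⟨0, ⊥, inferInstance, fun v => by simp, ?_⟩
    rintro ⟨f⟩
    obtain ⟨u, v, huv⟩ := hH
    exact f.toHom.map_adj huv
  have hbdd : BddAbove (regularFreeDegrees n H) := by
    refine ⟨n, ?_⟩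
    rintro k ⟨G, _, hG, _⟩
    have h1 := G.degree_lt_card_verts ⟨0, hn⟩
    have h2 : G.degree ⟨0, hn⟩ = k := hG _
    rw [h2, Fintype.card_fin] at h1
    exact h1.le
  exact ⟨Nat.sSup_mem hne hbdd, fun k hk => le_csSup hbdd hk⟩

/-! Upper bound: let G be k-regular on n vertices, without C_{2l-1}, with k > 2n/(2l+1) and n large.
Then G is bipartite (`IsRegularOfDegree.colorable_two_of_free`), so n is even and k ≤ n/2. For odd n
this leaves k ≤ 2n/(2l+1), and k is even by the handshake lemma.

Call an edge robust if it lies in a K_{2l,2l}. Density makes all but boundedly many edges at each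
vertex robust. An odd cycle of length at most 2l-1 through a robust edge would yield a C_{2l-1}
inside G, so a shortest odd cycle through a robust edge has length 2m+1 with m ≥ l. By minimality,
robust neighbourhoods of two of its vertices meet only at cycle distance two. If they meet for all
such pairs, full neighbourhoods obey the same rule and (2m+1)k ≤ 2n; if one pair fails, l+1 robust
neighbourhoods are disjoint. Both contradict density (`not_even_length_of_adj`).

So no odd cycle uses a robust edge. If G still had an odd cycle, a vertex v on an odd cycle,
farthest from a root, would cut off a bipartite piece attached only at v. Double counting makes the
number of edges from v out of the piece a multiple of k, yet it lies strictly between 0 and k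
(`IsRegularOfDegree.colorable_two`).

Lower bound: K_{n/2,n/2} for even n; for odd n, an uneven blow-up of C_{2l+1}, thinned between two
classes to become regular. It maps to C_{2l+1}, so it has no shorter odd cycle. -/

namespace SimpleGraph

/-! ### Robust edges -/

/-- Vertices `u` and `v` are robustly adjacent if the edge `uv` lies in a complete bipartite
subgraph with `s` vertices on each side. -/
def robustSubgraph {V : Type*} (G : SimpleGraph V) (s : ℕ) : SimpleGraph V where
  Adj u v := ∃ T W : Finset V, T.card = s ∧ W.card = s ∧ u ∈ T ∧ v ∈ W ∧
    ∀ t ∈ T, ∀ w ∈ W, G.Adj t w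
  symm := ⟨by
    rintro u v ⟨T, W, hT, hW, hu, hv, h⟩
    exact ⟨W, T, hW, hT, hv, hu, fun t ht w hw => (h w hw t ht).symm⟩⟩
  loopless := ⟨by
    rintro u ⟨T, W, -, -, hu, hv, h⟩
    exact G.loopless.irrefl u (h u hu u hv)⟩

theorem robustSubgraph_le {V : Type*} (G : SimpleGraph V) (s : ℕ) : G.robustSubgraph s ≤ G := by
  rintro u v ⟨T, W, -, -, hu, hv, h⟩
  exact h u hu v hv

/-- If no edge is closed to an odd cycle by a path of even length, the graph is bipartite. -/
theorem colorable_two_of_forall_isPath_not_even {V : Type*} {G : SimpleGraph V}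
    (h : ∀ u v, G.Adj u v → ∀ p : G.Walk u v, p.IsPath → ¬ Even p.length) : G.Colorable 2 := by
  classical
  -- `bypass` cuts out closed pieces made of an edge and a path between its ends; by `h` such a path
  -- is odd, so each piece is even.
  have key : ∀ u v (p : G.Walk u v), (Even p.length ↔ Even p.bypass.length) := by
    intro u v p
    induction p with
    | nil => simp [Walk.bypass]
    | @cons u x w hux p ih =>
      rw [Walk.bypass]
      split_ifs with hs
      · have h1 : ((p.bypass.takeUntil u hs).length) + (p.bypass.dropUntil u hs).length
            = p.bypass.length := by
          rw [← Walk.length_append, Walk.take_spec]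
        have h2 := h x u hux.symm _ ((p.bypass_isPath).takeUntil hs)
        rw [Walk.length_cons, Nat.even_add_one, ih, ← h1, Nat.even_add]
        tauto
      · rw [Walk.length_cons, Walk.length_cons, Nat.even_add_one, Nat.even_add_one, ih]
  rw [two_colorable_iff_forall_loop_even]
  intro u w
  rw [key]
  have := Walk.length_eq_zero_iff.2 (Walk.isPath_iff_nil.1 w.bypass_isPath)
  simp [this]

/-- In a complete bipartite graph with sides larger than the path, a path of even length joining
the two sides can be prolonged by two. -/
theorem exists_isPath_length_of_complete {V : Type*} {G : SimpleGraph V} {T W : Finset V} {s : ℕ}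
    (hT : T.card = s) (hW : W.card = s) (h : ∀ t ∈ T, ∀ w ∈ W, G.Adj t w) (j : ℕ) :
    ∀ {u v : V} (_ : u ∈ T) (_ : v ∈ W) (p : G.Walk u v) (_ : p.IsPath)
      (_ : p.length + 2 * j ≤ s),
      ∃ u' ∈ T, ∃ q : G.Walk u' v, q.IsPath ∧ q.length = p.length + 2 * j := by
  classical
  induction j with
  | zero => intro u v hu hv p hp _; exact ⟨u, hu, p, hp, rfl⟩
  | succ j ih =>
    intro u v hu hv p hp hs
    have hsupp : p.support.toFinset.card < s := by
      have := p.support.toFinset_card_le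
      rw [Walk.length_support] at this
      omega
    obtain ⟨w, hw, hwp⟩ := Finset.exists_mem_notMem_of_card_lt_card (hW ▸ hsupp)
    obtain ⟨t, ht, htp⟩ := Finset.exists_mem_notMem_of_card_lt_card (hT ▸ hsupp)
    rw [List.mem_toFinset] at hwp htp
    have htw : t ≠ w := (h t ht w hw).ne
    obtain ⟨u', hu', q, hq, hql⟩ := ih ht hv
      (Walk.cons (h t ht w hw) (Walk.cons (h u hu w hw).symm p))
      ((hp.cons hwp).cons (by simp [htw, htp])) (by simp only [Walk.length_cons]; omega)
    exact ⟨u', hu', q, hq, by rw [hql]; simp only [Walk.length_cons]; omega⟩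

/-- A path of even length between two adjacent vertices closes up to a cycle. -/
theorem cycleGraph_isContained_of_isPath {V : Type*} {G : SimpleGraph V} {u v : V}
    (huv : G.Adj u v) (p : G.Walk u v) (hp : p.IsPath) (hl : 2 ≤ p.length) :
    cycleGraph (p.length + 1) ⊑ G := by
  rw [cycleGraph_isContained_iff (by omega)]
  refine ⟨v, Walk.cons huv.symm p, ?_, by simp⟩
  rw [Walk.cons_isCycle_iff]
  refine ⟨hp, fun hmem => ?_⟩
  have := hp.length_eq_one_of_mem_edges (Sym2.eq_swap ▸ hmem)
  omega

/-- A shorter even path could be prolonged inside the complete bipartite graph to length exactly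
2l-2 and closed to the forbidden cycle. -/
theorem Free.le_length_of_robustSubgraph_adj {V : Type*} {G : SimpleGraph V} {l : ℕ}
    (hl : 2 ≤ l) (hfree : (cycleGraph (2 * l - 1)).Free G) {u v : V}
    (huv : (G.robustSubgraph (2 * l)).Adj u v) (p : G.Walk u v) (hp : p.IsPath)
    (he : Even p.length) : 2 * l ≤ p.length := by
  by_contra! hlt
  obtain ⟨i, hi⟩ := he
  obtain ⟨T, W, hT, hW, hu, hv, h⟩ := huv
  obtain ⟨u', hu', q, hq, hql⟩ := exists_isPath_length_of_complete hT hW h (l - 1 - i) hu hv p hp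
    (by omega)
  have := cycleGraph_isContained_of_isPath (h u' hu' v hv) q hq (by omega)
  rw [show q.length + 1 = 2 * l - 1 by omega] at this
  exact hfree this

/-- In a dense regular graph, a bounded number of neighbours of `v` already contains one side of a
large complete bipartite subgraph whose other side contains `v`. -/
theorem exists_robustSubgraph_adj {V : Type*} [Fintype V] {G : SimpleGraph V}
    [DecidableRel G.Adj] {k s : ℕ} (hreg : G.IsRegularOfDegree k) (hs : 0 < s) {v : V}
    {X : Finset V} (hX : ∀ x ∈ X, G.Adj v x) (hX0 : 0 < X.card)
    (hk : s * Fintype.card V + s * 2 ^ X.card * X.card ≤ X.card * k) :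
    ∃ x ∈ X, (G.robustSubgraph s).Adj v x := by
  classical
  have hsum : ∑ w : V, (X.filter fun x => G.Adj x w).card = X.card * k := by
    have h := Finset.sum_card_bipartiteAbove_eq_sum_card_bipartiteBelow (s := X)
      (t := Finset.univ) (r := G.Adj)
    unfold Finset.bipartiteAbove Finset.bipartiteBelow at h
    rw [← h, Finset.sum_const_nat]
    intro x _
    rw [← hreg x, ← card_neighborFinset_eq_degree, neighborFinset_eq_filter]
  -- Vertices outside `big` absorb fewer than s edges from X each, so `big` is large enough to
  -- pigeonhole over the traces on X: s of its vertices share a trace Y.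
  set big := Finset.univ.filter fun w => s ≤ (X.filter fun x => G.Adj x w).card with hbig
  have hle : X.card * k ≤ s * Fintype.card V + X.card * big.card := by
    rw [← hsum]
    calc ∑ w : V, (X.filter fun x => G.Adj x w).card
        ≤ ∑ w : V, (s + if w ∈ big then X.card else 0) := by
          refine Finset.sum_le_sum fun w _ => ?_
          split_ifs with h
          · exact (Finset.card_filter_le _ _).trans (by omega)
          · simp only [hbig, Finset.mem_filter, Finset.mem_univ, true_and] at h
            omega
      _ = _ := by
          rw [Finset.sum_add_distrib, Finset.sum_const, ← Finset.sum_filter, Finset.sum_const]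
          simp [mul_comm]
  have hbc : X.powerset.card * s ≤ big.card := by
    rw [Finset.card_powerset]
    have : X.card * (2 ^ X.card * s) ≤ X.card * big.card := by nlinarith
    exact Nat.le_of_mul_le_mul_left this hX0
  obtain ⟨Y, hY, hYc⟩ := Finset.exists_le_card_fiber_of_mul_le_card_of_maps_to
    (f := fun w => X.filter fun x => G.Adj x w) (s := big) (t := X.powerset)
    (fun w _ => Finset.mem_powerset.2 (Finset.filter_subset _ _)) ⟨∅, by simp⟩ hbc
  set F := big.filter fun w => (X.filter fun x => G.Adj x w) = Y with hF
  obtain ⟨w₀, hw₀⟩ : F.Nonempty := Finset.card_pos.1 (by omega)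
  have hYs : s ≤ Y.card := by
    simp only [hF, hbig, Finset.mem_filter, Finset.mem_univ, true_and] at hw₀
    rw [← hw₀.2]; exact hw₀.1
  obtain ⟨T, hTY, hT⟩ := Finset.exists_subset_card_eq hYs
  -- v may be forced into W because it is adjacent to all of X, hence to T ⊆ Y.
  obtain ⟨W, hvW, hWF, hW⟩ := Finset.exists_subsuperset_card_eq (s := {v}) (t := insert v F) (n := s)
    (by simp) (by rwa [Finset.card_singleton]) (hYc.trans (Finset.card_le_card (Finset.subset_insert _ _)))
  have hYX : Y ⊆ X := Finset.mem_powerset.1 hY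
  obtain ⟨x, hx⟩ : T.Nonempty := Finset.card_pos.1 (by omega)
  refine ⟨x, hYX (hTY hx), W, T, hW, hT, hvW (by simp), hx, fun w hw t ht => ?_⟩
  rcases Finset.mem_insert.1 (hWF hw) with rfl | hwF
  · exact hX t (hYX (hTY ht))
  · have := hTY ht
    rw [← (Finset.mem_filter.1 hwF).2] at this
    exact (Finset.mem_filter.1 this).2.symm

/-! ### Shortest odd cycles through a robust edge -/

section OddCycle

variable {m : ℕ}

theorem zmod_natCast_inj {a b : ℕ} (ha : a < 2 * m + 1) (hb : b < 2 * m + 1)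
    (h : (a : ZMod (2 * m + 1)) = b) : a = b := by
  rw [ZMod.natCast_eq_natCast_iff'] at h
  rwa [Nat.mod_eq_of_lt ha, Nat.mod_eq_of_lt hb] at h

theorem zmod_natCast_ne_zero {a : ℕ} (h0 : 0 < a) (ha : a < 2 * m + 1) :
    (a : ZMod (2 * m + 1)) ≠ 0 := fun h => by
  have := zmod_natCast_inj (b := 0) ha (by omega) (by simpa using h)
  omega

theorem zmod_two_mul_add_one : (2 * m + 1 : ZMod (2 * m + 1)) = 0 := by
  have := ZMod.natCast_self (2 * m + 1)
  push_cast at this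
  exact this

/-- Two distinct points of a cycle of odd length are joined by an arc of odd length. -/
theorem exists_odd_arc {i j : ZMod (2 * m + 1)} (hij : i ≠ j) :
    ∃ g : ℕ, Odd g ∧ g < 2 * m ∧ (j = i + g ∨ i = j + g) := by
  have hd : j - i ≠ 0 := sub_ne_zero.2 hij.symm
  have hlt := ZMod.val_lt (j - i)
  rcases Nat.even_or_odd (j - i).val with he | ho
  · refine ⟨2 * m + 1 - (j - i).val, ?_, ?_, Or.inr ?_⟩
    · exact Nat.Odd.sub_even hlt.le ⟨m, rfl⟩ he
    · have : (j - i).val ≠ 0 := by rwa [Ne, ZMod.val_eq_zero]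
      obtain ⟨x, hx⟩ := he
      omega
    · rw [Nat.cast_sub hlt.le, ZMod.natCast_zmod_val, ZMod.natCast_self]
      ring
  · refine ⟨(j - i).val, ho, ?_, Or.inl ?_⟩
    · obtain ⟨x, hx⟩ := ho
      omega
    · rw [ZMod.natCast_zmod_val]
      ring

/-- Two distinct points of a cycle of odd length are joined by an arc of even length. -/
theorem exists_even_arc {i j : ZMod (2 * m + 1)} (hij : i ≠ j) :
    ∃ g : ℕ, Even g ∧ 2 ≤ g ∧ g ≤ 2 * m ∧ (j = i + g ∨ i = j + g) := by
  obtain ⟨g, ho, hlt, h⟩ := exists_odd_arc hij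
  have hc : ((2 * m + 1 - g : ℕ) : ZMod (2 * m + 1)) = -g := by
    rw [Nat.cast_sub (by omega), ZMod.natCast_self, zero_sub]
  refine ⟨2 * m + 1 - g, Nat.Odd.sub_odd ⟨m, rfl⟩ ho, by omega, ?_, ?_⟩
  · obtain ⟨x, hx⟩ := ho
    omega
  · rw [hc]
    rcases h with h | h
    · right; rw [h]; ring
    · left; rw [h]; ring

/-- Sets indexed by the points of an odd cycle that meet only when the points are at distance two
cover every element at most twice. -/
theorem sum_card_le_two_mul_of_inter {V : Type*} [Fintype V] (hm : 3 ≤ m)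
    (f : ZMod (2 * m + 1) → Finset V)
    (hf : ∀ w i j, w ∈ f i → w ∈ f j → i ≠ j → i = j + 2 ∨ j = i + 2) :
    ∑ i, (f i).card ≤ 2 * Fintype.card V := by
  classical
  -- Three distinct points pairwise at distance two would force 2 = 0 or 6 = 0, excluded by 2m+1 ≥
  -- 7.
  have h2 : (2 : ZMod (2 * m + 1)) ≠ 0 := by
    exact_mod_cast zmod_natCast_ne_zero (m := m) (a := 2) (by omega) (by omega)
  have h6 : (6 : ZMod (2 * m + 1)) ≠ 0 := by
    exact_mod_cast zmod_natCast_ne_zero (m := m) (a := 6) (by omega) (by omega)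
  have h := Finset.sum_card_bipartiteAbove_eq_sum_card_bipartiteBelow
    (s := (Finset.univ : Finset (ZMod (2 * m + 1))))
    (t := (Finset.univ : Finset V)) (r := fun i w => w ∈ f i)
  unfold Finset.bipartiteAbove Finset.bipartiteBelow at h
  simp only [Finset.filter_mem_eq_inter, Finset.univ_inter] at h
  rw [h]
  refine (Finset.sum_le_card_nsmul _ _ 2 fun w _ => ?_).trans
    (by rw [Finset.card_univ, smul_eq_mul, mul_comm])
  by_contra! hlt
  obtain ⟨a, b, c, ha, hb, hc, hab, hac, hbc⟩ := Finset.two_lt_card_iff.1 hlt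
  simp only [Finset.mem_filter, Finset.mem_univ, true_and] at ha hb hc
  rcases hf w a b ha hb hab with h1 | h1 <;> rcases hf w a c ha hc hac with h3 | h3
  · exact hbc (by linear_combination h3 - h1)
  · rcases hf w b c hb hc hbc with h4 | h4
    · exact h6 (by linear_combination -h1 - h3 - h4)
    · exact h2 (by linear_combination h4 - h3 - h1)
  · rcases hf w b c hb hc hbc with h4 | h4
    · exact h2 (by linear_combination h4 - h3 - h1)
    · exact h6 (by linear_combination -h1 - h3 - h4)
  · exact hbc (by linear_combination h1 - h3)

/-- Sets indexed by the points of an odd cycle that meet only when the points are at distance two,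
and do not meet for one such pair: more than half of them are pairwise disjoint. -/
theorem mul_le_card_of_inter_of_disjoint {V : Type*} [Fintype V] {d l : ℕ} (hlm : l ≤ m)
    (f : ZMod (2 * m + 1) → Finset V) (hd : ∀ i, d ≤ (f i).card)
    (hf : ∀ w i j, w ∈ f i → w ∈ f j → i ≠ j → i = j + 2 ∨ j = i + 2)
    {t : ZMod (2 * m + 1)} (ht : ∀ w, w ∈ f t → w ∉ f (t + 2)) :
    (l + 1) * d ≤ Fintype.card V := by
  classical
  -- Start at t+2 and step by 4. An even multiple of 2m+1 that is at most 4m+2 is 0 or 4m+2, so only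
  -- steps 0 and m are at distance two; these are t+2 and t+2+4m = t, the pair known not to meet.
  have key : ∀ a b : ℕ, a < b → b ≤ m → ∀ w, w ∈ f (t + 2 + (4 * a : ℕ)) →
      w ∉ f (t + 2 + (4 * b : ℕ)) := by
    intro a b hab hb w hwa hwb
    obtain ⟨e, rfl⟩ := Nat.exists_eq_add_of_lt hab
    have aux : ∀ z : ℕ, (z : ZMod (2 * m + 1)) = 0 → z ≤ 4 * m + 2 → Even z → z ≠ 0 →
        z = 4 * m + 2 := by
      intro z hz hle he h0
      rw [ZMod.natCast_eq_zero_iff] at hz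
      obtain ⟨q, rfl⟩ := hz
      have hq : q < 3 := by by_contra! h; nlinarith
      obtain ⟨x, hx⟩ := he
      interval_cases q <;> omega
    have hne : t + 2 + ((4 * a : ℕ) : ZMod (2 * m + 1)) ≠ t + 2 + ((4 * (a + e + 1) : ℕ)) := by
      intro h
      have := aux (4 * (e + 1)) (by push_cast at h ⊢; linear_combination -h) (by omega)
        ⟨2 * (e + 1), by ring⟩ (by omega)
      omega
    rcases hf w _ _ hwa hwb hne with h | h
    · have := aux (4 * (e + 1) + 2) (by push_cast at h ⊢; linear_combination -h) (by omega)
        ⟨2 * (e + 1) + 1, by ring⟩ (by omega)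
      obtain rfl : a = 0 := by omega
      have hm : 0 + e + 1 = m := by omega
      rw [hm] at hwb
      refine ht w ?_ (by simpa using hwa)
      convert hwb using 2
      push_cast
      linear_combination (-2) * zmod_two_mul_add_one (m := m)
    · have := aux (4 * e + 2) (by push_cast at h ⊢; linear_combination h) (by omega)
        ⟨2 * e + 1, by ring⟩ (by omega)
      omega
  have hdisj : Set.PairwiseDisjoint (Finset.range (l + 1) : Set ℕ)
      fun s : ℕ => f (t + 2 + (4 * s : ℕ)) := by
    intro a ha b hb hab
    simp only [Finset.coe_range, Set.mem_Iio] at ha hb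
    refine Finset.disjoint_left.2 fun w hwa hwb => ?_
    rcases lt_or_gt_of_ne hab with h | h
    · exact key a b h (by omega) w hwa hwb
    · exact key b a h (by omega) w hwb hwa
  calc (l + 1) * d = ∑ s ∈ Finset.range (l + 1), d := by simp
    _ ≤ ∑ s ∈ Finset.range (l + 1), (f (t + 2 + (4 * s : ℕ))).card :=
        Finset.sum_le_sum fun s _ => hd _
    _ = _ := (Finset.card_biUnion hdisj).symm
    _ ≤ _ := Finset.card_le_univ _

variable {V : Type*} {G H : SimpleGraph V} {c : ZMod (2 * m + 1) → V}

theorem exists_isPath_arc (hinj : Function.Injective c) (hadj : ∀ i, G.Adj (c i) (c (i + 1)))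
    (i : ZMod (2 * m + 1)) (g : ℕ) (hg : g ≤ 2 * m) :
    ∃ p : G.Walk (c i) (c (i + g)), p.IsPath ∧ p.length = g ∧
      ∀ x ∈ p.support, ∃ s ≤ g, x = c (i + s) := by
  induction g with
  | zero =>
    refine ⟨Walk.nil.copy rfl (by simp), by simp, by simp, ?_⟩
    intro x hx
    exact ⟨0, le_rfl, by simpa using hx⟩
  | succ g ih =>
    obtain ⟨p, hp, hl, hs⟩ := ih (by omega)
    have hnot : c (i + g + 1) ∉ p.support := by
      intro hmem
      obtain ⟨s, hsg, hs'⟩ := hs _ hmem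
      have h1 := hinj hs'
      have := zmod_natCast_inj (m := m) (a := g + 1) (b := s) (by omega) (by omega)
        (by push_cast; linear_combination h1)
      omega
    have he : c (i + g + 1) = c (i + (g + 1 : ℕ)) := by push_cast; rw [add_assoc]
    refine ⟨(p.concat (hadj (i + g))).copy rfl he, ?_, ?_, ?_⟩
    · rw [Walk.isPath_copy]; exact hp.concat hnot _
    · simp [hl]
    · intro x hx
      rw [Walk.support_copy, Walk.support_concat, List.mem_append, List.mem_singleton] at hx
      rcases hx with hx | rfl
      · obtain ⟨s, hsg, rfl⟩ := hs x hx
        exact ⟨s, by omega, rfl⟩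
      · exact ⟨g + 1, le_rfl, he⟩

/-- If even paths between `H`-adjacent vertices are long, so are odd paths between vertices with a
common `H`-neighbour. -/
theorem le_length_of_common_adj (hHG : H ≤ G) {r : ℕ}
    (hmin : ∀ u v, H.Adj u v → ∀ p : G.Walk u v, p.IsPath → Even p.length → r ≤ p.length)
    {u x z : V} (hx : H.Adj u x) (hz : H.Adj u z) (p : G.Walk x z) (hp : p.IsPath)
    (ho : Odd p.length) : r ≤ p.length + 1 := by
  classical
  -- If u lies on p, one of the two parts is even and joins u to an H-neighbour; otherwise prepend
  -- u.
  by_cases hu : u ∈ p.support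
  · have h1 : (p.takeUntil u hu).length + (p.dropUntil u hu).length = p.length := by
      rw [← Walk.length_append, Walk.take_spec]
    rcases Nat.even_or_odd (p.takeUntil u hu).length with he | ho'
    · have := hmin x u hx.symm _ (hp.takeUntil hu) he
      omega
    · have he : Even (p.dropUntil u hu).length := by
        rw [← h1] at ho
        exact (Nat.odd_add.1 ho).1 ho'
      have := hmin u z hz _ (hp.dropUntil hu) he
      omega
  · have := hmin u z hz (Walk.cons (hHG hx) p) (hp.cons hu) (by
      rw [Walk.length_cons]; exact ho.add_one)
    rwa [Walk.length_cons] at this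

/-- The odd arc between two H-neighbours of u has length at least 2m-1, so the complementary arc has
length two. -/
theorem eq_add_two_of_common_adj (hHG : H ≤ G) (hinj : Function.Injective c)
    (hadj : ∀ i, G.Adj (c i) (c (i + 1)))
    (hmin : ∀ u v, H.Adj u v → ∀ p : G.Walk u v, p.IsPath → Even p.length → 2 * m ≤ p.length)
    {u : V} {i j : ZMod (2 * m + 1)} (hi : H.Adj u (c i)) (hj : H.Adj u (c j)) (hij : i ≠ j) :
    i = j + 2 ∨ j = i + 2 := by
  obtain ⟨g, ho, hlt, h⟩ := exists_odd_arc hij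
  wlog hji : j = i + g generalizing i j
  · exact (this hj hi hij.symm h.symm (h.resolve_left hji)).symm
  left
  subst hji
  obtain ⟨p, hp, hl, -⟩ := exists_isPath_arc hinj hadj i g hlt.le
  have := le_length_of_common_adj hHG hmin hi hj p hp (hl.symm ▸ ho)
  obtain ⟨x, hx⟩ := ho
  have hg : g + 2 = 2 * m + 1 := by omega
  have hg' : (g : ZMod (2 * m + 1)) + 2 = 2 * m + 1 := by exact_mod_cast congrArg Nat.cast hg
  linear_combination -hg' - zmod_two_mul_add_one (m := m)

/-- With b = a+g and g even, follow the arc from `c (a + 2)` to `c b`, then the chord to `c a`. This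
odd path joins two vertices with a common H-neighbour, so g = 2m and the chord is an edge of the
cycle. -/
theorem eq_add_one_of_chord (hHG : H ≤ G) (hinj : Function.Injective c)
    (hadj : ∀ i, G.Adj (c i) (c (i + 1)))
    (hmin : ∀ u v, H.Adj u v → ∀ p : G.Walk u v, p.IsPath → Even p.length → 2 * m ≤ p.length)
    (hcommon : ∀ i, ∃ u, H.Adj u (c i) ∧ H.Adj u (c (i + 2)))
    {a b : ZMod (2 * m + 1)} (hab : G.Adj (c a) (c b)) : a = b + 1 ∨ b = a + 1 := by
  obtain ⟨g, he, h2, hg, h⟩ := exists_even_arc (fun h : a = b => hab.ne (congrArg c h))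
  wlog hba : b = a + g generalizing a b
  · exact (this hab.symm h.symm (h.resolve_left hba)).symm
  left
  obtain ⟨e, rfl⟩ := Nat.exists_eq_add_of_le' h2
  obtain rfl : b = a + 2 + e := by rw [hba]; push_cast; ring
  have hee : Even e := by simpa [Nat.even_add] using he
  obtain ⟨p, hp, hl, hs⟩ := exists_isPath_arc hinj hadj (a + 2) e (by omega)
  have hnot : c a ∉ p.support := by
    intro hmem
    obtain ⟨s, hse, hs'⟩ := hs _ hmem
    refine zmod_natCast_ne_zero (m := m) (a := s + 2) (by omega) (by omega) ?_
    push_cast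
    linear_combination -hinj hs'
  obtain ⟨u, hu1, hu2⟩ := hcommon a
  have := le_length_of_common_adj hHG hmin hu2 hu1 (p.concat hab.symm) (hp.concat hnot _)
    (by rw [Walk.length_concat, hl]; exact hee.add_one)
  rw [Walk.length_concat, hl] at this
  have heq : e + 2 = 2 * m := by omega
  have hg' : (e : ZMod (2 * m + 1)) + 2 = 2 * m := by exact_mod_cast congrArg Nat.cast heq
  linear_combination -hg' - zmod_two_mul_add_one (m := m)

/-- Extends the distance-two rule from H to G. For w off the cycle and j = i+g with g odd, g = 1
gives a path of length 3 from `c i` to `c (i + 2)`, too short as m ≥ 3. Otherwise the arc from `c (i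
+ 2)` to `c j`, closed through w to `c i`, is an odd path and forces g = 2m-1. -/
theorem eq_add_two_of_adj_of_adj (hm : 3 ≤ m) (hHG : H ≤ G) (hinj : Function.Injective c)
    (hadj : ∀ i, G.Adj (c i) (c (i + 1)))
    (hmin : ∀ u v, H.Adj u v → ∀ p : G.Walk u v, p.IsPath → Even p.length → 2 * m ≤ p.length)
    (hcommon : ∀ i, ∃ u, H.Adj u (c i) ∧ H.Adj u (c (i + 2)))
    {w : V} {i j : ZMod (2 * m + 1)} (hi : G.Adj w (c i)) (hj : G.Adj w (c j)) (hij : i ≠ j) :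
    i = j + 2 ∨ j = i + 2 := by
  by_cases hw : ∃ a, w = c a
  · obtain ⟨a, rfl⟩ := hw
    rcases eq_add_one_of_chord hHG hinj hadj hmin hcommon hi with h1 | h1 <;>
      rcases eq_add_one_of_chord hHG hinj hadj hmin hcommon hj with h2 | h2
    · exact absurd (by linear_combination h2 - h1) hij
    · right; linear_combination h2 + h1
    · left; linear_combination h2 + h1
    · exact absurd (by linear_combination h1 - h2) hij
  push Not at hw
  obtain ⟨g, ho, hlt, h⟩ := exists_odd_arc hij
  wlog hji : j = i + g generalizing i j
  · exact (this hj hi hij.symm h.symm (h.resolve_left hji)).symm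
  left
  subst hji
  obtain ⟨u, hu1, hu2⟩ := hcommon i
  rcases Nat.lt_or_ge g 2 with hg2 | hg2
  · obtain rfl : g = 1 := by obtain ⟨x, hx⟩ := ho; omega
    have hj' : G.Adj w (c (i + 1)) := by simpa using hj
    have h12 : G.Adj (c (i + 1)) (c (i + 2)) := by
      have := hadj (i + 1)
      rwa [show i + 1 + 1 = i + 2 by ring] at this
    have hne : c i ≠ c (i + 2) := by
      intro h
      have h0 := hinj h
      refine zmod_natCast_ne_zero (m := m) (a := 2) (by omega) (by omega) ?_
      push_cast
      linear_combination -h0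
    have := le_length_of_common_adj hHG hmin hu1 hu2
      (Walk.cons hi.symm (Walk.cons hj' (Walk.cons h12 Walk.nil)))
      (by simp [hne, (hadj i).ne, h12.ne, hw, (hw i).symm]) ⟨1, rfl⟩
    simp only [Walk.length_cons, Walk.length_nil] at this
    omega
  obtain ⟨e, rfl⟩ := Nat.exists_eq_add_of_le' hg2
  have hoe : Odd e := by simpa [Nat.odd_add] using ho
  obtain ⟨p, hp, hl, hs⟩ := exists_isPath_arc hinj hadj (i + 2) e (by omega)
  have hj' : G.Adj w (c (i + 2 + e)) := by
    convert hj using 2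
    push_cast
    ring
  have hnot : c i ∉ p.support := by
    intro hmem
    obtain ⟨s, hse, hs'⟩ := hs _ hmem
    refine zmod_natCast_ne_zero (m := m) (a := s + 2) (by omega) (by omega) ?_
    push_cast
    linear_combination -hinj hs'
  have hwnot : w ∉ p.support := by
    intro hmem
    obtain ⟨s, hse, hs'⟩ := hs _ hmem
    exact hw _ hs'
  have := le_length_of_common_adj hHG hmin hu2 hu1 ((p.concat hj'.symm).concat hi)
    ((hp.concat hwnot _).concat (by
      rw [Walk.support_concat, List.mem_append, List.mem_singleton, not_or]
      exact ⟨hnot, (hw i).symm⟩) _)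
    (by rw [Walk.length_concat, Walk.length_concat, hl]; exact hoe.add_one.add_one)
  rw [Walk.length_concat, Walk.length_concat, hl] at this
  obtain ⟨x, hx⟩ := hoe
  have hg : e + 2 + 2 = 2 * m + 1 := by omega
  have hg' : (e : ZMod (2 * m + 1)) + 2 + 2 = 2 * m + 1 := by
    exact_mod_cast congrArg Nat.cast hg
  push_cast
  linear_combination -hg' - zmod_two_mul_add_one (m := m)

/-- A path of even length between adjacent vertices is an odd cycle. -/
theorem exists_cycle_of_isPath {a b : V} (hab : G.Adj a b) (p : G.Walk a b) (hp : p.IsPath)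
    (hl : p.length = 2 * m) :
    ∃ c : ZMod (2 * m + 1) → V, Function.Injective c ∧ ∀ i, G.Adj (c i) (c (i + 1)) := by
  refine ⟨fun i => p.getVert i.val, fun i j hij => ?_, fun i => ?_⟩
  · refine ZMod.val_injective _ (hp.getVert_injOn ?_ ?_ hij)
    · have := ZMod.val_lt i
      simp only [Set.mem_ofPred_eq]; omega
    · have := ZMod.val_lt j
      simp only [Set.mem_ofPred_eq]; omega
  · have hlt := ZMod.val_lt i
    show G.Adj (p.getVert i.val) (p.getVert (i + 1).val)
    have hi : i + 1 = ((i.val + 1 : ℕ) : ZMod (2 * m + 1)) := by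
      rw [Nat.cast_add, ZMod.natCast_zmod_val, Nat.cast_one]
    rcases Nat.lt_or_ge i.val (2 * m) with h | h
    · rw [hi, ZMod.val_cast_of_lt (by omega)]
      exact p.adj_getVert_succ (by omega)
    · have hv : i.val = 2 * m := by omega
      rw [hi, hv, ZMod.natCast_self, ZMod.val_zero, Walk.getVert_zero, ← hl, Walk.getVert_length]
      exact hab.symm

/-- In a dense regular graph `G`, if a spanning subgraph `H` loses few edges at every vertex and
no short odd cycle of `G` uses an edge of `H`, then no odd cycle of `G` uses an edge of `H`. -/
theorem not_even_length_of_adj [Fintype V] [DecidableRel G.Adj] [DecidableRel H.Adj]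
    {k d l : ℕ} (hl : 3 ≤ l) (hHG : H ≤ G) (hreg : G.IsRegularOfDegree k)
    (hd : ∀ v, d ≤ H.degree v)
    (hshort : ∀ u v, H.Adj u v → ∀ p : G.Walk u v, p.IsPath → Even p.length → 2 * l ≤ p.length)
    (hk : 2 * Fintype.card V < k * (2 * l + 1)) (hdl : Fintype.card V < (l + 1) * d)
    {u v : V} (huv : H.Adj u v) (p : G.Walk u v) (hp : p.IsPath) : ¬ Even p.length := by
  classical
  intro he
  have hex : ∃ r, ∃ (u v : V) (p : G.Walk u v), H.Adj u v ∧ p.IsPath ∧ Even p.length ∧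
    p.length = r := ⟨_, u, v, p, huv, hp, he, rfl⟩
  obtain ⟨a, b, q, hab, hq, hqe, hql⟩ := Nat.find_spec hex
  obtain ⟨m, hm⟩ := hqe
  have hqm : q.length = 2 * m := by omega
  have hmin : ∀ u v, H.Adj u v → ∀ p : G.Walk u v, p.IsPath → Even p.length →
      2 * m ≤ p.length := by
    intro u v huv p hp he
    rw [← hqm, hql]
    exact Nat.find_min' hex ⟨u, v, p, huv, hp, he, rfl⟩
  have hlm : l ≤ m := by
    have := hshort a b hab q hq ⟨m, hm⟩
    omega
  obtain ⟨c, hinj, hadj⟩ := exists_cycle_of_isPath (hHG hab) q hq hqm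
  -- The first case contradicts `hk` through (2m+1)k ≤ 2n, the second contradicts `hdl`.
  by_cases hcommon : ∀ i, ∃ u, H.Adj u (c i) ∧ H.Adj u (c (i + 2))
  · have := sum_card_le_two_mul_of_inter (by omega) (fun i => G.neighborFinset (c i))
      (fun w i j hi hj hij => by
        rw [mem_neighborFinset] at hi hj
        exact eq_add_two_of_adj_of_adj (by omega) hHG hinj hadj hmin hcommon hi.symm hj.symm hij)
    simp only [card_neighborFinset_eq_degree, hreg _, Finset.sum_const, Finset.card_univ,
      ZMod.card, smul_eq_mul] at this
    nlinarith
  · push Not at hcommon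
    obtain ⟨t, ht⟩ := hcommon
    have := mul_le_card_of_inter_of_disjoint (d := d) hlm (fun i => H.neighborFinset (c i))
      (fun i => by rw [card_neighborFinset_eq_degree]; exact hd _)
      (fun w i j hi hj hij => by
        rw [mem_neighborFinset] at hi hj
        exact eq_add_two_of_common_adj hHG hinj hadj hmin hi.symm hj.symm hij)
      (t := t) (fun w h1 h2 => by
        rw [mem_neighborFinset] at h1 h2
        exact ht w h1.symm h2.symm)
    omega

end OddCycle

/-! ### From robust edges to bipartiteness -/

section Bipartite

variable {V : Type*} {G H : SimpleGraph V}

theorem Walk.IsPath.append_of_inter {a b c : V} {p : G.Walk a b} {q : G.Walk b c} (hp : p.IsPath)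
    (hq : q.IsPath) (h : ∀ z ∈ p.support, z ∈ q.support → z = b) : (p.append q).IsPath := by
  rw [Walk.isPath_def, Walk.support_append, List.nodup_append]
  have hq' := hq.support_nodup
  rw [← Walk.cons_tail_support, List.nodup_cons] at hq'
  refine ⟨hp.support_nodup, hq'.2, ?_⟩
  rintro z hz _ hz' rfl
  have := h z hz (List.mem_of_mem_tail hz')
  exact hq'.1 (this ▸ hz')

/-- The initial segment of a walk up to the first visit to `S`. -/
theorem Walk.exists_walk_first_mem {S : Set V} {a b : V} (r : G.Walk a b) (hb : b ∈ S) :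
    ∃ x ∈ S, ∃ q : G.Walk a x, q.support ⊆ r.support ∧ ∀ z ∈ q.support, z ∈ S → z = x := by
  induction r with
  | nil => exact ⟨_, hb, Walk.nil, by simp, by simp⟩
  | @cons a a' b h r ih =>
    by_cases ha : a ∈ S
    · exact ⟨a, ha, Walk.nil, by simp, by simp⟩
    · obtain ⟨x, hx, q, hqr, hq⟩ := ih hb
      refine ⟨x, hx, Walk.cons h q, ?_, ?_⟩
      · rw [Walk.support_cons, Walk.support_cons]
        exact List.cons_subset_cons a hqr
      · intro z hz hzS
        rw [Walk.support_cons, List.mem_cons] at hz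
        rcases hz with rfl | hz
        · exact absurd hzS ha
        · exact hq z hz hzS

/-- A neighbour `y` of a vertex `v` on an odd cycle that reaches the rest of the cycle without
passing through `v` is joined to `v` by a path of even length. -/
theorem exists_isPath_even_of_avoiding {u v y : V} (huv : G.Adj u v) (p : G.Walk u v)
    (hp : p.IsPath) (he : Even p.length) (r : G.Walk y u) (hr : v ∉ r.support) :
    ∃ q : G.Walk y v, q.IsPath ∧ Even q.length := by
  classical
  obtain ⟨x, hx, q₀, hq₀, hq₀'⟩ := r.exists_walk_first_mem (S := {z | z ∈ p.support})
    p.start_mem_support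
  have hx : x ∈ p.support := hx
  set q := q₀.bypass with hqdef
  have hq : q.IsPath := q₀.bypass_isPath
  have hqx : ∀ z ∈ q.support, z ∈ p.support → z = x := fun z hz hzp =>
    hq₀' z (q₀.support_bypass_subset_support hz) hzp
  have hvx : v ≠ x := by
    rintro rfl
    exact hr (hq₀ q₀.end_mem_support)
  have hlen : (p.takeUntil x hx).length + (p.dropUntil x hx).length = p.length := by
    rw [← Walk.length_append, Walk.take_spec]
  -- The two arcs from x to v on the odd cycle have opposite parity; one of them completes q to an
  -- even path.
  by_cases hpar : Even (q.length + (p.dropUntil x hx).length)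
  · refine ⟨q.append (p.dropUntil x hx), hq.append_of_inter (hp.dropUntil hx) fun z hz hz' =>
      hqx z hz (p.support_dropUntil_subset_support hx hz'), ?_⟩
    rwa [Walk.length_append]
  · have hv : v ∉ (p.takeUntil x hx).reverse.support := by
      rw [Walk.support_reverse, List.mem_reverse]
      exact Walk.endpoint_notMem_support_takeUntil hp hx hvx
    refine ⟨q.append ((p.takeUntil x hx).reverse.concat huv), hq.append_of_inter
      ((hp.takeUntil hx).reverse.concat hv huv) fun z hz hz' => hqx z hz ?_, ?_⟩
    · rw [Walk.support_concat, List.mem_append, List.mem_singleton, Walk.support_reverse,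
        List.mem_reverse] at hz'
      rcases hz' with hz' | rfl
      · exact p.support_takeUntil_subset_support hx hz'
      · exact p.end_mem_support
    · rw [Walk.length_append, Walk.length_concat, Walk.length_reverse]
      rw [← hlen] at he
      grind

theorem isCycle_cons_of_isPath_even {u v : V} (huv : G.Adj v u) (p : G.Walk u v)
    (hp : p.IsPath) (he : Even p.length) :
    (Walk.cons huv p).IsCycle ∧ Odd (Walk.cons huv p).length := by
  refine ⟨(Walk.cons_isCycle_iff _ _).2 ⟨hp, fun hmem => ?_⟩, ?_⟩
  · have := hp.length_eq_one_of_mem_edges (Sym2.eq_swap ▸ hmem)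
    rw [this] at he
    exact absurd he (by decide)
  · rw [Walk.length_cons]
    exact he.add_one

/-- The two sides of an induced bipartite subgraph of a `k`-regular graph: if `Z` sends edges to
its complement only from `v`, their number is a multiple of `k`. -/
theorem dvd_card_of_colorable_induce [Fintype V] [DecidableRel G.Adj] {k : ℕ}
    (hreg : G.IsRegularOfDegree k) (Z : Set V) [DecidablePred (· ∈ Z)] {v : V} (hv : v ∈ Z)
    (hZ : ∀ z ∈ Z, z ≠ v → ∀ y, G.Adj z y → y ∈ Z) (hcol : (G.induce Z).Colorable 2) :
    k ∣ ((G.neighborFinset v).filter (· ∉ Z)).card := by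
  classical
  obtain ⟨C⟩ := hcol
  set col : V → Fin 2 := fun x => if h : x ∈ Z then C ⟨x, h⟩ else 0 with hcoldef
  have hne : ∀ x y, x ∈ Z → y ∈ Z → G.Adj x y → col x ≠ col y := by
    intro x y hx hy hxy
    simp only [hcoldef, dif_pos hx, dif_pos hy]
    exact C.valid (by simpa using hxy)
  set A := Finset.univ.filter fun x => x ∈ Z ∧ col x = col v
  set B := Finset.univ.filter fun x => x ∈ Z ∧ col x ≠ col v
  -- Edges inside Z number k|B| counted from B, and k(|A|-1) plus the degree of v within Z counted
  -- from A.
  have hcount := Finset.sum_card_bipartiteAbove_eq_sum_card_bipartiteBelow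
    (s := A) (t := B) (r := G.Adj)
  have hB : ∑ y ∈ B, (A.bipartiteBelow G.Adj y).card = B.card * k := by
    refine Finset.sum_const_nat fun y hy => ?_
    simp only [B, Finset.mem_filter, Finset.mem_univ, true_and] at hy
    rw [← hreg y, ← card_neighborFinset_eq_degree]
    congr 1
    ext x
    simp only [A, Finset.mem_bipartiteBelow, Finset.mem_filter, Finset.mem_univ, true_and,
      mem_neighborFinset]
    refine ⟨fun h => h.2.symm, fun h => ?_⟩
    have hx := hZ y hy.1 (fun h => hy.2 (h ▸ rfl)) x h
    have := hne y x hy.1 hx h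
    exact ⟨⟨hx, by have := hy.2; omega⟩, h.symm⟩
  have hA : ∀ x ∈ A, (B.bipartiteAbove G.Adj x).card =
      ((G.neighborFinset x).filter (· ∈ Z)).card := by
    intro x hx
    simp only [A, Finset.mem_filter, Finset.mem_univ, true_and] at hx
    congr 1
    ext y
    simp only [B, Finset.mem_bipartiteAbove, Finset.mem_filter, Finset.mem_univ, true_and,
      mem_neighborFinset]
    refine ⟨fun h => ⟨h.2, h.1.1⟩, fun h => ⟨⟨h.2, ?_⟩, h.1⟩⟩
    have := hne x y hx.1 h.2 h.1
    rw [hx.2] at this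
    exact this.symm
  have hvA : v ∈ A := by simp [A, hv]
  rw [Finset.sum_congr rfl hA, hB, ← Finset.add_sum_erase _ _ hvA, Finset.sum_const_nat (m := k)]
    at hcount
  · have hsplit := Finset.card_filter_add_card_filter_not (s := G.neighborFinset v) (· ∈ Z)
    rw [card_neighborFinset_eq_degree, hreg v] at hsplit
    have h1 : k ∣ ((G.neighborFinset v).filter (· ∈ Z)).card := by
      rw [← Nat.dvd_add_left (Dvd.intro_left _ rfl), hcount]
      exact Dvd.intro_left _ rfl
    rw [← Nat.dvd_add_right h1, hsplit]
  · intro x hx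
    rw [Finset.mem_erase] at hx
    rw [Finset.filter_true_of_mem, card_neighborFinset_eq_degree, hreg x]
    intro y hy
    rw [mem_neighborFinset] at hy
    have hxZ := hx.2
    simp only [A, Finset.mem_filter, Finset.mem_univ, true_and] at hxZ
    exact hZ x hxZ.1 hx.1 y hy

/-- A regular graph is bipartite as soon as every vertex has an edge and some spanning subgraph
without isolated vertices has no edge on an odd cycle. -/
theorem IsRegularOfDegree.colorable_two [Fintype V] [DecidableRel G.Adj] [DecidableRel H.Adj]
    {k : ℕ} (hreg : G.IsRegularOfDegree k) (hHG : H ≤ G) (hd : ∀ v, 0 < H.degree v)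
    (hno : ∀ u v, H.Adj u v → ∀ p : G.Walk u v, p.IsPath → ¬ Even p.length) : G.Colorable 2 := by
  classical
  by_contra hcol
  obtain ⟨ρ, b, hρb, p₀, hp₀, he₀⟩ :
      ∃ u v, G.Adj u v ∧ ∃ p : G.Walk u v, p.IsPath ∧ Even p.length := by
    by_contra! h
    exact hcol (colorable_two_of_forall_isPath_not_even fun u v huv p hp he =>
      absurd he (Nat.not_even_iff_odd.2 (by simpa using h u v huv p hp)))
  set O : V → Prop := fun v => ∃ p : G.Walk v v, p.IsCycle ∧ Odd p.length with hO
  have hOpath : ∀ {u v : V}, G.Adj u v → ∀ p : G.Walk u v, p.IsPath → Even p.length → O v :=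
    fun huv p hp he => ⟨_, isCycle_cons_of_isPath_even huv.symm p hp he⟩
  have hOρ : O ρ := hOpath hρb.symm p₀.reverse hp₀.reverse (by rwa [Walk.length_reverse])
  obtain ⟨v, hv, hmax⟩ := Finset.exists_max_image
    (Finset.univ.filter fun v => O v ∧ G.Reachable v ρ) (fun v => G.dist v ρ)
    ⟨ρ, by simp [hOρ]⟩
  simp only [Finset.mem_filter, Finset.mem_univ, true_and] at hv hmax
  obtain ⟨⟨C, hC, hCodd⟩, hvρ⟩ := hv
  -- Z is v together with what v separates from ρ. By the maximal distance, v is the only vertex of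
  -- Z on an odd cycle.
  set Z : Set V := {z | G.Reachable z ρ ∧ ∀ q : G.Walk z ρ, v ∈ q.support} with hZdef
  have hvZ : v ∈ Z := ⟨hvρ, fun q => q.start_mem_support⟩
  have hZ : ∀ z ∈ Z, z ≠ v → ∀ y, G.Adj z y → y ∈ Z := by
    intro z hz hzv y hzy
    refine ⟨hzy.symm.reachable.trans hz.1, fun q => ?_⟩
    have := hz.2 (Walk.cons hzy q)
    rw [Walk.support_cons, List.mem_cons] at this
    exact this.resolve_left hzv.symm
  have hOZ : ∀ x, O x → x ∈ Z → x = v := by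
    intro x hx hxZ
    by_contra hne
    obtain ⟨q, hq⟩ := hxZ.1.exists_walk_length_eq_dist
    have h1 := hmax x ⟨hx, hxZ.1⟩
    have hvq := hxZ.2 q
    have h2 : (q.takeUntil v hvq).length + (q.dropUntil v hvq).length = q.length := by
      rw [← Walk.length_append, Walk.take_spec]
    have h3 := dist_le (q.dropUntil v hvq)
    have h4 : (q.takeUntil v hvq).length ≠ 0 := fun h => hne (Walk.eq_of_length_eq_zero h)
    omega
  have hadj : G.Adj v C.snd := C.adj_snd hC.not_nil
  have htail : Even C.tail.length := by
    have := C.length_tail_add_one hC.not_nil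
    rw [← this] at hCodd
    simpa [Nat.odd_add] using hCodd
  have hOsnd : O C.snd := hOpath hadj C.tail.reverse hC.isPath_tail.reverse
    (by rwa [Walk.length_reverse])
  have hsnd : C.snd ∉ Z := fun h => hadj.ne (hOZ _ hOsnd h).symm
  have havoid : ∀ y, G.Adj v y → y ∉ Z → ∃ q : G.Walk y ρ, v ∉ q.support := by
    intro y hvy hy
    by_contra! h
    exact hy ⟨hvy.symm.reachable.trans hvρ, h⟩
  -- Such y reaches the odd cycle C through ρ while avoiding v, so the edge yv closes an even path.
  have hnotH : ∀ y, G.Adj v y → y ∉ Z → ¬ H.Adj y v := by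
    intro y hvy hy hH
    obtain ⟨q₁, hq₁⟩ := havoid y hvy hy
    obtain ⟨q₂, hq₂⟩ := havoid _ hadj hsnd
    obtain ⟨q, hq, hqe⟩ := exists_isPath_even_of_avoiding hadj.symm C.tail hC.isPath_tail htail
      (q₁.append q₂.reverse) (by
        rw [Walk.mem_support_append_iff, Walk.support_reverse, List.mem_reverse]
        tauto)
    exact hno y v hH q hq hqe
  have hbip : (G.induce Z).Colorable 2 := by
    refine colorable_two_of_forall_isPath_not_even fun x y hxy p hp he => ?_
    have hxy' : G.Adj x y := by simpa using hxy
    obtain ⟨q, hq, hqe⟩ : ∃ q : G.Walk x.1 y.1, q.IsPath ∧ Even q.length :=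
      ⟨p.map (Embedding.induce Z).toHom, hp.map (Embedding.induce (G := G) Z).injective,
        (congrArg Even (Walk.length_map _ p)).mpr he⟩
    have hx : O y := hOpath hxy' q hq hqe
    have hy : O x := hOpath hxy'.symm q.reverse hq.reverse (by rwa [Walk.length_reverse])
    exact hxy'.ne ((hOZ _ hy x.2).trans (hOZ _ hx y.2).symm)
  have hdvd := dvd_card_of_colorable_induce hreg Z hvZ hZ hbip
  have hpos : 0 < ((G.neighborFinset v).filter (· ∉ Z)).card :=
    Finset.card_pos.2 ⟨C.snd, by simp [hadj, hsnd]⟩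
  have hlt : ((G.neighborFinset v).filter (· ∉ Z)).card < k := by
    rw [← hreg v, ← card_neighborFinset_eq_degree]
    refine Finset.card_lt_card ((Finset.filter_ssubset).2 ?_)
    obtain ⟨y, hy⟩ := Finset.card_pos.1 ((H.card_neighborFinset_eq_degree v).symm ▸ hd v)
    rw [mem_neighborFinset] at hy
    exact ⟨y, by simpa using hHG hy, fun h => hnotH y (hHG hy) h hy.symm⟩
  exact absurd (Nat.le_of_dvd hpos hdvd) (by omega)

/-- The two sides of a bipartite regular graph have equal size. -/
theorem IsRegularOfDegree.even_card_and_le_of_colorable_two [Fintype V] [DecidableRel G.Adj]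
    {k : ℕ} (hreg : G.IsRegularOfDegree k) (hk : 0 < k) (hcol : G.Colorable 2) :
    Even (Fintype.card V) ∧ (2 * k ≤ Fintype.card V ∨ Fintype.card V = 0) := by
  classical
  obtain ⟨C⟩ := hcol
  have hsum : ∀ i j : Fin 2, i ≠ j → ∀ x, C x = i →
      (Finset.univ.filter fun y => C y = j ∧ G.Adj x y).card = k := by
    intro i j hij x hx
    rw [← hreg x, ← card_neighborFinset_eq_degree, neighborFinset_eq_filter]
    congr 1
    ext y
    simp only [Finset.mem_filter, Finset.mem_univ, true_and, and_iff_right_iff_imp]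
    intro hxy
    have := C.valid hxy
    omega
  set A := Finset.univ.filter fun x => C x = 0
  set B := Finset.univ.filter fun x => C x = 1
  have hcount := Finset.sum_card_bipartiteAbove_eq_sum_card_bipartiteBelow
    (s := A) (t := B) (r := G.Adj)
  have hA : ∀ x ∈ A, (B.bipartiteAbove G.Adj x).card = k := fun x hx => by
    rw [← hsum 0 1 (by decide) x (by simpa [A] using hx)]
    congr 1; ext y; simp [B, Finset.mem_bipartiteAbove]
  have hB : ∀ x ∈ B, (A.bipartiteBelow G.Adj x).card = k := fun x hx => by
    rw [← hsum 1 0 (by decide) x (by simpa [B] using hx)]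
    congr 1; ext y; simp [A, Finset.mem_bipartiteBelow, adj_comm]
  rw [Finset.sum_const_nat hA, Finset.sum_const_nat hB] at hcount
  have hAB : A.card = B.card := Nat.eq_of_mul_eq_mul_right hk hcount
  have htot : A.card + B.card = Fintype.card V := by
    have := Finset.card_filter_add_card_filter_not (s := (Finset.univ : Finset V))
      (fun x => C x = 0)
    rw [Finset.card_univ] at this
    rw [← this]
    congr 2
    ext x
    simp only [B, Finset.mem_filter, Finset.mem_univ, true_and]
    omega
  refine ⟨⟨A.card, by omega⟩, ?_⟩
  rcases A.eq_empty_or_nonempty with h | ⟨x, hx⟩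
  · right
    rw [h, Finset.card_empty] at hAB
    rw [h, Finset.card_empty] at htot
    omega
  · left
    have h1 := hA x hx
    have h2 : (B.bipartiteAbove G.Adj x).card ≤ B.card := Finset.card_filter_le _ _
    omega

end Bipartite

/-! ### Dense graphs are bipartite -/

/-- A dense regular graph without `C_{2l-1}` of large degree is bipartite. -/
theorem IsRegularOfDegree.colorable_two_of_free {V : Type*} [Fintype V] {G : SimpleGraph V}
    [DecidableRel G.Adj] {k l : ℕ} (hl : 3 ≤ l) (hreg : G.IsRegularOfDegree k)
    (hfree : (cycleGraph (2 * l - 1)).Free G)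
    (hk : 2 * Fintype.card V < k * (2 * l + 1))
    (hlarge : 2 * (2 ^ (2 * l * (l + 1)) * (2 * l * (l + 1))) ≤ k) : G.Colorable 2 := by
  classical
  set b := 2 * l * (l + 1) with hb
  have hlb : l + 1 ≤ 2 ^ b := by
    have : b < 2 ^ b := Nat.lt_two_pow_self
    nlinarith
  have hbk : 2 * ((l + 1) * b) ≤ k :=
    (Nat.mul_le_mul_left 2 (Nat.mul_le_mul_right b hlb)).trans hlarge
  have hb0 : 0 < b := by positivity
  set H := G.robustSubgraph (2 * l)
  have hHG : H ≤ G := G.robustSubgraph_le _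
  have hdeg : ∀ v, k - b ≤ H.degree v := by
    intro v
    have hsplit := Finset.card_filter_add_card_filter_not (s := G.neighborFinset v) (H.Adj v ·)
    rw [card_neighborFinset_eq_degree, hreg v] at hsplit
    have h1 : ((G.neighborFinset v).filter (H.Adj v ·)).card ≤ H.degree v := by
      rw [← card_neighborFinset_eq_degree]
      refine Finset.card_le_card fun x hx => ?_
      rw [mem_neighborFinset]
      exact (Finset.mem_filter.1 hx).2
    -- With b = 2l(l+1), the counting hypothesis reduces to n + 2^b b ≤ (l+1)k, which holds since
    -- 2(l+1)k > 2n + k.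
    have h2 : ((G.neighborFinset v).filter (¬ H.Adj v ·)).card < b := by
      by_contra! h
      obtain ⟨X, hX, hXc⟩ := Finset.exists_subset_card_eq h
      obtain ⟨x, hx, hvx⟩ := exists_robustSubgraph_adj (s := 2 * l) (v := v) (X := X) hreg
        (by omega)
        (fun x hx => by simpa using (Finset.mem_filter.1 (hX hx)).1) (by omega) (by
          rw [hXc]
          calc 2 * l * Fintype.card V + 2 * l * 2 ^ b * b
              = 2 * l * (Fintype.card V + 2 ^ b * b) := by ring
            _ ≤ 2 * l * ((l + 1) * k) := by
                refine Nat.mul_le_mul_left _ ?_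
                nlinarith
            _ = b * k := by rw [hb]; ring)
      exact (Finset.mem_filter.1 (hX hx)).2 hvx
    omega
  have hbk' : b < k := by nlinarith
  have hdl : Fintype.card V < (l + 1) * (k - b) := by
    obtain ⟨e, rfl⟩ := Nat.exists_eq_add_of_lt hbk'
    rw [show b + e + 1 - b = e + 1 by omega]
    nlinarith
  refine hreg.colorable_two hHG (fun v => lt_of_lt_of_le (by omega) (hdeg v)) fun u v huv p hp => ?_
  exact not_even_length_of_adj hl hHG hreg hdeg
    (fun u v huv p hp he => hfree.le_length_of_robustSubgraph_adj (by omega) huv p hp he)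
    hk hdl huv p hp

/-! ### Constructions for the lower bounds -/

theorem mem_regularFreeDegrees_of_card {V W : Type*} [Fintype V] {n k : ℕ} {G : SimpleGraph V}
    [DecidableRel G.Adj] {H : SimpleGraph W} (hn : Fintype.card V = n)
    (hreg : G.IsRegularOfDegree k) (hfree : H.Free G) : k ∈ regularFreeDegrees n H := by
  classical
  refine ⟨G.overFin hn, inferInstance, fun v => ?_, ?_⟩
  · rw [← hreg ((G.overFinIso hn).symm v)]
    exact ((G.overFinIso hn).symm.degree_eq v).symm
  · rwa [← free_congr_right (G.overFinIso hn)]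

theorem Colorable.free_cycleGraph {V : Type*} {G : SimpleGraph V} (h : G.Colorable 2) {n : ℕ}
    (hn : 2 < n) (ho : Odd n) : (cycleGraph n).Free G := by
  intro hc
  obtain ⟨v, p, -, hp⟩ := (cycleGraph_isContained_iff hn).1 hc
  have := two_colorable_iff_forall_loop_even.1 h v p
  rw [hp] at this
  exact Nat.not_even_iff_odd.2 ho this

/-- Here b counts the steps on which φ decreases. -/
theorem Walk.exists_sub_eq_length_sub {V : Type*} {G : SimpleGraph V} {m : ℕ} (φ : V → ZMod m)
    (hφ : ∀ u v, G.Adj u v → φ v = φ u + 1 ∨ φ u = φ v + 1) {u v : V} (p : G.Walk u v) :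
    ∃ b ≤ p.length, φ v - φ u = p.length - 2 * b := by
  induction p with
  | nil => exact ⟨0, by simp⟩
  | @cons u x v h p ih =>
    obtain ⟨b, hb, hb'⟩ := ih
    rcases hφ u x h with h' | h'
    · refine ⟨b, by rw [Walk.length_cons]; omega, ?_⟩
      rw [Walk.length_cons]; push_cast
      linear_combination hb' + h'
    · refine ⟨b + 1, by rw [Walk.length_cons]; omega, ?_⟩
      rw [Walk.length_cons]; push_cast
      linear_combination hb' - h'

/-- A graph with a homomorphism to an odd cycle contains no shorter odd cycle. -/
theorem free_cycleGraph_of_hom_zmod {V : Type*} {G : SimpleGraph V} {n m : ℕ} (φ : V → ZMod m)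
    (hφ : ∀ u v, G.Adj u v → φ v = φ u + 1 ∨ φ u = φ v + 1) (hn : 2 < n) (ho : Odd n)
    (hnm : n < m) : (cycleGraph n).Free G := by
  intro hc
  obtain ⟨v, p, -, hp⟩ := (cycleGraph_isContained_iff hn).1 hc
  obtain ⟨b, hb, h⟩ := p.exists_sub_eq_length_sub φ hφ
  rw [hp] at h hb
  rw [sub_self] at h
  -- Since |n - 2b| ≤ n < m, divisibility by m forces n = 2b.
  have h' : (((n : ℤ) - 2 * b : ℤ) : ZMod m) = 0 := by push_cast; exact h.symm
  rw [ZMod.intCast_zmod_eq_zero_iff_dvd] at h'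
  have h0 := Int.eq_zero_of_abs_lt_dvd h' (by rw [abs_lt]; constructor <;> omega)
  obtain ⟨x, hx⟩ := ho
  omega

/-- The blow-up of the cycle on `{0, …, 2l}` in which every vertex is replaced by infinitely many,
and pairs between the classes `2l` and `0` are deleted according to a residue modulo `c`. -/
def cycleBlowup (l r c : ℕ) : SimpleGraph (Σ _ : ℕ, ℕ) :=
  fromRel fun p q => p.1 + 1 = q.1 ∨ (p.1 = 0 ∧ q.1 = 2 * l ∧ r ≤ (p.2 + q.2) % c)

theorem cycleBlowup_adj {l r c : ℕ} (hl : 0 < l) {p q : Σ _ : ℕ, ℕ} :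
    (cycleBlowup l r c).Adj p q ↔ p.1 + 1 = q.1 ∨ q.1 + 1 = p.1 ∨
      ((p.1 = 0 ∧ q.1 = 2 * l ∨ p.1 = 2 * l ∧ q.1 = 0) ∧ r ≤ (p.2 + q.2) % c) := by
  rw [cycleBlowup, fromRel_adj, add_comm q.2]
  constructor
  · tauto
  · intro h
    refine ⟨?_, by tauto⟩
    rintro rfl
    omega

/-- Translation permutes residues; this counts the neighbours surviving the thinning between the two
end classes. -/
theorem card_filter_le_add_mod (r c x : ℕ) :
    ((Finset.range c).filter fun y => r ≤ (x + y) % c).card = c - r := by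
  have h := Nat.filter_Ico_card_eq_of_periodic x c (fun y => r ≤ y % c)
    (fun y => by simp)
  rw [Nat.count_eq_card_filter_range] at h
  have h1 : (Finset.range c).filter (fun y => r ≤ y % c) = Finset.Ico r c := by
    ext y
    simp only [Finset.mem_filter, Finset.mem_range, Finset.mem_Ico]
    constructor
    · rintro ⟨h1, h2⟩; rw [Nat.mod_eq_of_lt h1] at h2; exact ⟨h2, h1⟩
    · rintro ⟨h1, h2⟩; rw [Nat.mod_eq_of_lt h2]; exact ⟨h2, h1⟩
  rw [h1, Nat.card_Ico] at h
  rw [← h, ← Finset.card_image_of_injective _ (add_right_injective x)]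
  congr 1
  ext z
  simp only [Finset.mem_image, Finset.mem_filter, Finset.mem_range, Finset.mem_Ico]
  constructor
  · rintro ⟨y, ⟨h1, h2⟩, rfl⟩; exact ⟨⟨by omega, by omega⟩, h2⟩
  · rintro ⟨⟨h1, h2⟩, h3⟩
    exact ⟨z - x, ⟨by omega, by rwa [Nat.add_sub_cancel' h1]⟩, Nat.add_sub_cancel' h1⟩

/-- The vertex set of a finite blow-up with class sizes `a`. -/
def blowupVerts (l : ℕ) (a : ℕ → ℕ) : Finset (Σ _ : ℕ, ℕ) :=
  (Finset.range (2 * l + 1)).sigma fun i => Finset.range (a i)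

-- Inner classes see a(j-1) + a(j+1) = 2q; each end class sees its full neighbouring class and c-r
-- vertices of the other end class, again 2q.
open scoped Classical in
theorem card_filter_cycleBlowup_adj {l q r c : ℕ} (hl : 2 ≤ l) (a : ℕ → ℕ) (hrc : r ≤ c)
    (ha : ∀ i, a i + a (i + 2) = 2 * q) (h0 : a 0 = c) (h2l : a (2 * l) = c)
    (h1 : a 1 + c = 2 * q + r) (h1' : a (2 * l - 1) + c = 2 * q + r)
    {p : Σ _ : ℕ, ℕ} (hp : p ∈ blowupVerts l a) :
    ((blowupVerts l a).filter ((cycleBlowup l r c).Adj p)).card = 2 * q := by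
  obtain ⟨j, x⟩ := p
  simp only [blowupVerts, Finset.mem_sigma, Finset.mem_range] at hp
  obtain ⟨hj, -⟩ := hp
  rw [Finset.card_filter, blowupVerts, Finset.sum_sigma]
  have hg : ∀ i ∈ Finset.range (2 * l + 1), (∑ y ∈ Finset.range (a i),
      if (cycleBlowup l r c).Adj ⟨j, x⟩ ⟨i, y⟩ then 1 else 0) =
      (if i + 1 = j then a i else 0) + (if j + 1 = i then a i else 0) +
      (if j = 0 ∧ i = 2 * l ∨ j = 2 * l ∧ i = 0 then c - r else 0) := by
    intro i _
    rw [← Finset.card_filter]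
    simp only [cycleBlowup_adj (show 0 < l by omega)]
    by_cases hA : i + 1 = j
    · rw [if_pos hA, if_neg (by omega), if_neg (by omega), Finset.filter_true_of_mem,
        Finset.card_range]
      · omega
      · intro y _
        tauto
    by_cases hB : j + 1 = i
    · rw [if_neg hA, if_pos hB, if_neg (by omega), Finset.filter_true_of_mem, Finset.card_range]
      · omega
      · intro y _
        tauto
    rw [if_neg hA, if_neg hB]
    by_cases hC : j = 0 ∧ i = 2 * l ∨ j = 2 * l ∧ i = 0
    · have hai : a i = c := by rcases hC with ⟨-, rfl⟩ | ⟨-, rfl⟩ <;> assumption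
      rw [if_pos hC, hai, ← card_filter_le_add_mod r c x, zero_add, zero_add]
      congr 1
      ext y
      simp only [Finset.mem_filter]
      tauto
    · rw [if_neg hC, Finset.filter_false_of_mem]
      · simp
      · intro y _
        tauto
  rw [Finset.sum_congr rfl hg, Finset.sum_add_distrib, Finset.sum_add_distrib, Finset.sum_ite_eq]
  have hs1 : ∑ i ∈ Finset.range (2 * l + 1), (if i + 1 = j then a i else 0) =
      if j = 0 then 0 else a (j - 1) := by
    split_ifs with h
    · exact Finset.sum_eq_zero fun i _ => if_neg (by omega)
    · rw [Finset.sum_eq_single (j - 1), if_pos (by omega)]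
      · intro i _ hi; exact if_neg (by omega)
      · intro h'; rw [Finset.mem_range] at h'; omega
  have hs3 : ∑ i ∈ Finset.range (2 * l + 1),
      (if j = 0 ∧ i = 2 * l ∨ j = 2 * l ∧ i = 0 then c - r else 0) =
      if j = 0 ∨ j = 2 * l then c - r else 0 := by
    split_ifs with h
    · rw [Finset.sum_eq_single (2 * l - j), if_pos (by omega)]
      · intro i _ hi; exact if_neg (by omega)
      · intro h'; rw [Finset.mem_range] at h'; omega
    · exact Finset.sum_eq_zero fun i _ => if_neg (by omega)
  rw [hs1, hs3]
  simp only [Finset.mem_range]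
  rcases Nat.eq_zero_or_pos j with rfl | hj0
  · rw [if_pos rfl, if_pos (by omega), if_pos (by omega)]
    simp only [zero_add]
    omega
  rcases Nat.lt_or_ge j (2 * l) with hj2 | hj2
  · rw [if_neg (by omega), if_pos (by omega), if_neg (by omega)]
    have := ha (j - 1)
    rw [show j - 1 + 2 = j + 1 by omega] at this
    omega
  · obtain rfl : j = 2 * l := by omega
    rw [if_neg (by omega), if_neg (by omega), if_pos (by omega)]
    omega

theorem two_mul_mem_regularFreeDegrees {l q r c : ℕ} (hl : 2 ≤ l) (a : ℕ → ℕ) (hrc : r ≤ c)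
    (ha : ∀ i, a i + a (i + 2) = 2 * q) (h0 : a 0 = c) (h2l : a (2 * l) = c)
    (h1 : a 1 + c = 2 * q + r) (h1' : a (2 * l - 1) + c = 2 * q + r) :
    2 * q ∈ regularFreeDegrees (∑ i ∈ Finset.range (2 * l + 1), a i)
      (cycleGraph (2 * l - 1)) := by
  classical
  refine mem_regularFreeDegrees_of_card (V := blowupVerts l a)
    (G := (cycleBlowup l r c).comap Subtype.val) ?_ (fun v => ?_) ?_
  · rw [Fintype.card_coe, blowupVerts, Finset.card_sigma]
    simp
  · rw [← card_filter_cycleBlowup_adj hl a hrc ha h0 h2l h1 h1' v.2,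
      ← card_neighborFinset_eq_degree, ← Finset.card_map (Function.Embedding.subtype _)]
    congr 1
    ext z
    rw [Finset.mem_filter, Finset.mem_map]
    constructor
    · rintro ⟨w, hw, rfl⟩
      exact ⟨w.2, by simpa using hw⟩
    · rintro ⟨hz, hz'⟩
      exact ⟨⟨z, hz⟩, by simpa using hz', rfl⟩
  · refine free_cycleGraph_of_hom_zmod (m := 2 * l + 1) (fun v => (v.1.1 : ZMod (2 * l + 1))) ?_
      (by omega) ⟨l - 1, by omega⟩ (by omega)
    intro u v huv
    have h := (cycleBlowup_adj (by omega)).1 (show (cycleBlowup l r c).Adj u.1 v.1 from huv)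
    have hz := zmod_two_mul_add_one (m := l)
    rcases h with h | h | ⟨⟨hu, hv⟩ | ⟨hu, hv⟩, -⟩
    · left; rw [← h]; push_cast; ring
    · right; rw [← h]; push_cast; ring
    · right; rw [hu, hv]; push_cast; exact hz.symm
    · left; rw [hu, hv]; push_cast; exact hz.symm

theorem sum_range_four_mul {a : ℕ → ℕ} {q : ℕ} (ha : ∀ i, a i + a (i + 2) = 2 * q) (t : ℕ) :
    ∑ i ∈ Finset.range (4 * t), a i = 4 * t * q := by
  induction t with
  | zero => simp
  | succ t ih =>
    rw [show 4 * (t + 1) = 4 * t + 1 + 1 + 1 + 1 by ring]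
    simp only [Finset.sum_range_succ, ih]
    have h1 := ha (4 * t)
    have h2 := ha (4 * t + 1)
    rw [show 4 * t + 1 + 1 = 4 * t + 2 by ring, show 4 * t + 2 + 1 = 4 * t + 1 + 2 by ring]
    nlinarith

theorem two_mul_div_mem_regularFreeDegrees {l n : ℕ} (hl : 2 ≤ l)
    (hn : (2 * l + 1) * (2 * l + 1) ≤ n) :
    2 * (n / (2 * l + 1)) ∈ regularFreeDegrees n (cycleGraph (2 * l - 1)) := by
  set q := n / (2 * l + 1)
  set r := n % (2 * l + 1)
  have hqr : (2 * l + 1) * q + r = n := Nat.div_add_mod n _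
  have hr : r < 2 * l + 1 := Nat.mod_lt _ (by omega)
  -- Ensures r ≤ q, so that the class size q - r below is not truncated.
  have hq : 2 * l + 1 ≤ q := (Nat.le_div_iff_mul_le (by omega)).2 hn
  -- Sizes have period 4 and four consecutive ones sum to 4q; the surplus r is left over from the
  -- incomplete last period, whose shape depends on the parity of l.
  rcases Nat.even_or_odd' l with ⟨t, rfl | rfl⟩
  · set a : ℕ → ℕ := fun i => if i % 4 = 0 then q + r else if i % 4 = 2 then q - r else q with hadef
    have ha : ∀ i, a i + a (i + 2) = 2 * q := by
      intro i; simp only [hadef]; split_ifs <;> omega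
    have h2l : a (2 * (2 * t)) = q + r := by simp only [hadef]; split_ifs <;> omega
    have h := two_mul_mem_regularFreeDegrees (l := 2 * t) (r := r) (c := q + r) hl a (by omega) ha
      (by simp [hadef]) h2l (by simp [hadef]; omega)
      (by simp only [hadef]; split_ifs <;> omega)
    have hsum : ∑ i ∈ Finset.range (2 * (2 * t) + 1), a i = n := by
      rw [Finset.sum_range_succ, h2l, show 2 * (2 * t) = 4 * t by ring, sum_range_four_mul ha,
        ← hqr]
      ring
    rwa [hsum] at h
  · set a : ℕ → ℕ := fun i => if i % 4 = 1 then q + r else if i % 4 = 3 then q - r else q with hadef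
    have ha : ∀ i, a i + a (i + 2) = 2 * q := by
      intro i; simp only [hadef]; split_ifs <;> omega
    have h2l : a (2 * (2 * t + 1)) = q := by simp only [hadef]; split_ifs <;> omega
    have h := two_mul_mem_regularFreeDegrees (l := 2 * t + 1) (r := r) (c := q) hl a (by omega) ha
      (by simp [hadef]) h2l (by simp [hadef]; omega)
      (by simp only [hadef]; split_ifs <;> omega)
    have e0 : a (4 * t) = q := by simp only [hadef]; split_ifs <;> omega
    have e1 : a (4 * t + 1) = q + r := by simp only [hadef]; split_ifs <;> omega
    have hsum : ∑ i ∈ Finset.range (2 * (2 * t + 1) + 1), a i = n := by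
      rw [Finset.sum_range_succ, h2l, show 2 * (2 * t + 1) = 4 * t + 1 + 1 by ring,
        Finset.sum_range_succ, Finset.sum_range_succ, sum_range_four_mul ha, e0, e1, ← hqr]
      ring
    rwa [hsum] at h

theorem half_mem_regularFreeDegrees {n m : ℕ} (hn : Even n) (hm : 2 < m) (ho : Odd m) :
    n / 2 ∈ regularFreeDegrees n (cycleGraph m) := by
  classical
  refine mem_regularFreeDegrees_of_card (V := Fin (n / 2) ⊕ Fin (n / 2))
    (G := completeBipartiteGraph _ _) ?_ ?_ (Colorable.free_cycleGraph ?_ hm ho)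
  · rw [Fintype.card_sum, Fintype.card_fin]
    obtain ⟨x, hx⟩ := hn
    omega
  · rintro (v | v)
    · rw [← card_neighborFinset_eq_degree, show neighborFinset _ (Sum.inl v) =
        Finset.univ.map Function.Embedding.inr by ext (x | x) <;> simp]
      simp
    · rw [← card_neighborFinset_eq_degree, show neighborFinset _ (Sum.inr v) =
        Finset.univ.map Function.Embedding.inl by ext (x | x) <;> simp]
      simp
  · exact (CompleteBipartiteGraph.bicoloring _ _).colorable.mono (by simp)

end SimpleGraph

/-! ### Assembly -/

theorem mainTheorem1 (l : ℕ) (hl : 3 ≤ l) :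
    ∃ N : ℕ, ∀ n : ℕ, N ≤ n →
      (Even n →
        regularTuranNumber n (SimpleGraph.cycleGraph (2 * l - 1)) = n / 2) ∧
      (Odd n →
        regularTuranNumber n (SimpleGraph.cycleGraph (2 * l - 1)) = 2 * (n / (2 * l + 1))) := by
  set K := 2 * (2 ^ (2 * l * (l + 1)) * (2 * l * (l + 1))) with hK
  refine ⟨(2 * l + 1) * (2 * l + 1) * (K + 1), fun n hn => ?_⟩
  have hn1 : (2 * l + 1) * (2 * l + 1) ≤ n := le_trans (Nat.le_mul_of_pos_right _ (by omega)) hn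
  have hn2 : (2 * l + 1) * K ≤ n := by
    refine le_trans (Nat.mul_le_mul ?_ (Nat.le_succ K)) hn
    exact Nat.le_mul_of_pos_left _ (by omega)
  have upper : ∀ k ∈ regularFreeDegrees n (SimpleGraph.cycleGraph (2 * l - 1)),
      2 * n < k * (2 * l + 1) → Even n ∧ 2 * k ≤ n := by
    rintro k ⟨G, _, hreg, hfree⟩ hk
    have hkK : K ≤ k := by nlinarith
    have hcol := hreg.colorable_two_of_free hl hfree (by simpa using hk) hkK
    have h := hreg.even_card_and_le_of_colorable_two (by nlinarith) hcol
    rw [Fintype.card_fin] at h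
    exact ⟨h.1, h.2.resolve_right (by nlinarith)⟩
  refine ⟨fun he => ?_, fun ho => ?_⟩
  · refine IsGreatest.csSup_eq ⟨SimpleGraph.half_mem_regularFreeDegrees he (by omega)
      ⟨l - 1, by omega⟩, fun k hk => ?_⟩
    by_contra! hlt
    have := (upper k hk (by have : n < 2 * k := by omega
                            nlinarith)).2
    omega
  · refine IsGreatest.csSup_eq ⟨SimpleGraph.two_mul_div_mem_regularFreeDegrees (by omega) hn1,
      fun k hk => ?_⟩
    by_contra! hlt
    have hke : Even k := by
      obtain ⟨G, _, hreg, -⟩ := hk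
      have h := G.sum_degrees_eq_twice_card_edges
      simp only [hreg _, Finset.sum_const, Finset.card_univ, Fintype.card_fin, smul_eq_mul] at h
      have : Even (n * k) := ⟨_, h.trans (two_mul _)⟩
      exact (Nat.even_mul.1 this).resolve_left (Nat.not_even_iff_odd.2 ho)
    have hdiv := Nat.lt_div_mul_add (a := n) (b := 2 * l + 1) (by omega)
    obtain ⟨x, hx⟩ := hke
    -- As k = 2x, exceeding the claimed value means x(2l+1) > n, which is the density hypothesis of
    -- `upper`.
    have h2 : n / (2 * l + 1) + 1 ≤ x := by omega
    have := (upper k hk (by nlinarith)).1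
    exact Nat.not_even_iff_odd.2 ho this
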